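/- Let $A$ be a commutative ring and let $\varpi\in A$ be a non-zero-divisor and a non-unit. A $\varpi$-$\ast$-operation on $A$ is a map $I\mapsto I^{\ast}$ from the set of all $A$-submodules of $A[\varpi^{-1}]$ to itself such that, for all $A$-submodules $I,J$ of $A[\varpi^{-1}]$: $I\subseteq I^{\ast}$; $I\subseteq J$ implies $I^{\ast}\subseteq J^{\ast}$; $(I^{\ast})^{\ast}=I^{\ast}$; and $J I^{\ast}\subseteq (JI)^{\ast}$. It is called strict if $A^{\ast}=A$. Its finite-type companion $\ast_f$ is the $\varpi$-$\ast$-operation given by $I^{\ast_f}=\bigcup F^{\ast}$, where $F$ ranges over the finitely generated $A$-submodules of $I$. An ideal $I$ of $A$ is a $\ast$-ideal if $I^{\ast}=I$, and a maximal $\ast$-ideal is a maximal element, with respect to inclusion, of the set of proper ideals of $A$ which are $\ast$-ideals (and similarly for $\ast_f$; if $\ast$ is strict, maximal $\ast_f$-ideals are prime). If $\ast$ is strict, $A$ is called a $\ast$-multiplication ring if for every $f\in A$ and every integer $n\geq 1$ there exists a finitely generated $A$-submodule $J$ of $A[\varpi^{-1}]$ with $(J\cdot(f,\varpi^{n})_{A})^{\ast}=A$.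 A ring $B$ in which $\varpi$ is a non-zero-divisor is called $\varpi$-valuative if every finitely generated ideal $I$ of $B$ containing a power of $\varpi$ is invertible, i.e. $IJ=B$ for some $B$-submodule $J$ of $B[\varpi^{-1}]$. For $F\in A[X]$, let $c(F)$ denote the ideal of $A$ generated by the coefficients of $F$. **Theorem.** Let $\ast$ be a strict $\varpi$-$\ast$-operation on $A$ and let $\ast_f$ be its finite-type companion. The following are equivalent: 1. $A$ is a $\ast$-multiplication ring. 2. $A$ is integrally closed in $A[\varpi^{-1}]$ and, for every $f\in A$ and every integer $n\geq1$, the ideal $(\varpi^{n}X-f)A[\varpi^{-1}][X]\cap A[X]$ of $A[X]$ contains a polynomial $F$ with $c(F)^{\ast}=A$. 3. $A_{\mathfrak p}$ is $\varpi$-valuative for every maximal $\ast_f$-ideal $\mathfrak p$ of $A$. 4. $A_{\mathfrak p}$ is $\varpi$-valuative for every prime ideal $\mathfrak p$ of $A$ which is a $\ast_f$-ideal. -/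

import Mathlib

/-- A `ϖ`-star-operation on `A`: an operation `I ↦ I^∗` on the set of all `A`-submodules of
`A[ϖ⁻¹]` which is extensive, monotone, idempotent and satisfies `J I^∗ ⊆ (J I)^∗`. -/
structure PiStarOperation (A : Type*) [CommRing A] (ϖ : A) where
  /-- The operation `I ↦ I^∗`. -/
  cl : Submodule A (Localization.Away ϖ) → Submodule A (Localization.Away ϖ)
  le_cl : ∀ I, I ≤ cl I
  cl_mono : ∀ I J, I ≤ J → cl I ≤ cl J
  cl_cl : ∀ I, cl (cl I) = cl I
  mul_cl_le : ∀ I J, J * cl I ≤ cl (J * I)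

namespace PiStarOperation

variable {A : Type*} [CommRing A] {ϖ : A} (star : PiStarOperation A ϖ)

/-- A `ϖ`-star-operation is strict if `A^∗ = A`; here `1` is the submodule `A` of `A[ϖ⁻¹]`, that
is, the image of `A`. -/
def IsStrict : Prop :=
  star.cl 1 = 1

/-- The `∗`-product `(I J)^∗` of two submodules of `A[ϖ⁻¹]`. -/
def starMul (I J : Submodule A (Localization.Away ϖ)) : Submodule A (Localization.Away ϖ) :=
  star.cl (I * J)

/-- The closure `I^∗` of an ideal `I` of `A`, regarded as a submodule of `A[ϖ⁻¹]`. -/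
def clIdeal (I : Ideal A) : Submodule A (Localization.Away ϖ) :=
  star.cl (IsLocalization.coeSubmodule (Localization.Away ϖ) I)

/-- An ideal `I` of `A` is a `∗`-ideal if `I^∗ = I` as submodules of `A[ϖ⁻¹]`. -/
def IsStarIdeal (I : Ideal A) : Prop :=
  star.clIdeal I = IsLocalization.coeSubmodule (Localization.Away ϖ) I

/-- A maximal `∗`-ideal is a maximal element of the set of proper `∗`-ideals of `A`. -/
def IsMaximalStarIdeal (p : Ideal A) : Prop :=
  Maximal (fun I : Ideal A => I ≠ ⊤ ∧ star.IsStarIdeal I) p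

/-- The finite-type companion `∗_f`: the module `I^{∗_f}` is the union of the modules `F^∗`, where
`F` runs over the finitely generated submodules of `I`. -/
def finiteType : PiStarOperation A ϖ where
  cl I :=
    { carrier := {x | ∃ F : Submodule A (Localization.Away ϖ), F.FG ∧ F ≤ I ∧ x ∈ star.cl F}
      zero_mem' := ⟨⊥, Submodule.fg_bot, bot_le, zero_mem _⟩
      add_mem' := by
        rintro x y ⟨F, hF, hFI, hx⟩ ⟨G, hG, hGI, hy⟩
        exact ⟨F ⊔ G, hF.sup hG, sup_le hFI hGI,
          add_mem (star.cl_mono _ _ le_sup_left hx) (star.cl_mono _ _ le_sup_right hy)⟩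
      smul_mem' := by
        rintro a x ⟨F, hF, hFI, hx⟩
        exact ⟨F, hF, hFI, Submodule.smul_mem _ a hx⟩ }
  le_cl I x hx :=
    ⟨Submodule.span A {x}, Submodule.fg_span_singleton x,
      (Submodule.span_singleton_le_iff_mem x I).2 hx,
      star.le_cl _ (Submodule.mem_span_singleton_self x)⟩
  cl_mono := by
    rintro I J h x ⟨F, hF, hFI, hx⟩
    exact ⟨F, hF, hFI.trans h, hx⟩
  cl_cl I := by
    refine le_antisymm ?_ ?_
    · rintro x ⟨F, hF, hFI, hx⟩
      have key : ∃ G : Submodule A (Localization.Away ϖ), G.FG ∧ G ≤ I ∧ F ≤ star.cl G := by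
        clear hx
        induction F, hF using Submodule.fg_induction with
        | singleton y =>
          obtain ⟨G, hG, hGI, hy⟩ := hFI (Submodule.mem_span_singleton_self y)
          exact ⟨G, hG, hGI, (Submodule.span_singleton_le_iff_mem y _).2 hy⟩
        | sup F₁ F₂ _ _ h₁ h₂ =>
          obtain ⟨G₁, hG₁, hGI₁, hF₁⟩ := h₁ (le_sup_left.trans hFI)
          obtain ⟨G₂, hG₂, hGI₂, hF₂⟩ := h₂ (le_sup_right.trans hFI)
          exact ⟨G₁ ⊔ G₂, hG₁.sup hG₂, sup_le hGI₁ hGI₂,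
            sup_le (hF₁.trans (star.cl_mono _ _ le_sup_left))
              (hF₂.trans (star.cl_mono _ _ le_sup_right))⟩
      obtain ⟨G, hG, hGI, hFG⟩ := key
      refine ⟨G, hG, hGI, ?_⟩
      rw [← star.cl_cl G]
      exact star.cl_mono _ _ hFG hx
    · intro x hx
      exact ⟨Submodule.span A {x}, Submodule.fg_span_singleton x,
        (Submodule.span_singleton_le_iff_mem x _).2 hx,
        star.le_cl _ (Submodule.mem_span_singleton_self x)⟩
  mul_cl_le I J := by
    refine Submodule.mul_le.2 ?_
    rintro y hy x ⟨F, hF, hFI, hx⟩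
    refine ⟨Submodule.span A {y} * F, (Submodule.fg_span_singleton y).mul hF,
      mul_le_mul' ((Submodule.span_singleton_le_iff_mem y J).2 hy) hFI, ?_⟩
    exact star.mul_cl_le F _ (Submodule.mul_mem_mul (Submodule.mem_span_singleton_self y) hx)

variable {star}

theorem IsStrict.finiteType (h : star.IsStrict) : star.finiteType.IsStrict := by
  refine le_antisymm ?_ (star.finiteType.le_cl 1)
  rintro x ⟨F, -, hF, hx⟩
  have h1 : star.cl 1 = 1 := h
  rw [← h1]
  exact star.cl_mono _ _ hF hx

/-- For a strict operation every maximal `∗`-ideal is prime, so one can localize at it. -/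
theorem IsMaximalStarIdeal.isPrime (hϖ : ϖ ∈ nonZeroDivisors A) (hs : star.IsStrict) {p : Ideal A}
    (hp : star.IsMaximalStarIdeal p) : p.IsPrime := by
  have hinj : Function.Injective (algebraMap A (Localization.Away ϖ)) :=
    IsLocalization.injective _ (Submonoid.powers_le.2 hϖ)
  have hs1 : star.cl 1 = 1 := hs
  have memp : ∀ x : A, algebraMap A (Localization.Away ϖ) x ∈
      IsLocalization.coeSubmodule (Localization.Away ϖ) p → x ∈ p := by
    intro x hx
    obtain ⟨y, hy, hyx⟩ := (IsLocalization.mem_coeSubmodule _ p).1 hx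
    exact hinj hyx ▸ hy
  refine ⟨hp.1.1, fun {a b} hab => or_iff_not_imp_left.2 fun ha => memp b ?_⟩
  -- `K` is the ideal of `A` whose image in `A[ϖ⁻¹]` is the closure of `p + a A`.
  set M := star.clIdeal (p ⊔ Ideal.span {a}) with hM
  have hM1 : M ≤ 1 := by
    rw [← hs1]
    refine star.cl_mono _ _ ?_
    rw [← IsLocalization.coeSubmodule_top (R := A) (Localization.Away ϖ)]
    exact IsLocalization.coeSubmodule_mono _ le_top
  let K : Ideal A := M.comap (Algebra.linearMap A (Localization.Away ϖ))
  have hKM : IsLocalization.coeSubmodule (Localization.Away ϖ) K = M := by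
    refine le_antisymm ?_ ?_
    · rintro _ ⟨y, hy, rfl⟩
      exact hy
    · intro x hx
      obtain ⟨y, rfl⟩ := Submodule.mem_one.1 (hM1 hx)
      exact ⟨y, hx, rfl⟩
  have hle : p ⊔ Ideal.span {a} ≤ K := fun y hy =>
    star.le_cl _ ((IsLocalization.mem_coeSubmodule _ _).2 ⟨y, hy, rfl⟩)
  have hK : star.IsStarIdeal K := by
    show star.cl _ = _
    rw [hKM, hM]
    exact star.cl_cl _
  have hKtop : K = ⊤ := by
    by_contra hne
    exact ha (hp.2 ⟨hne, hK⟩ (le_sup_left.trans hle)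
      (hle (Ideal.mem_sup_right (Ideal.mem_span_singleton_self a))))
  have h1 : (1 : Localization.Away ϖ) ∈ M := by
    have : (1 : A) ∈ K := hKtop ▸ Submodule.mem_top
    simpa using (show algebraMap A (Localization.Away ϖ) 1 ∈ M from this)
  have hpst : star.cl (IsLocalization.coeSubmodule (Localization.Away ϖ) p) =
    IsLocalization.coeSubmodule (Localization.Away ϖ) p := hp.1.2
  have h2 : algebraMap A (Localization.Away ϖ) b * 1 ∈
      IsLocalization.coeSubmodule (Localization.Away ϖ) (Ideal.span {b}) * M :=
    Submodule.mul_mem_mul ((IsLocalization.mem_coeSubmodule _ _).2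
      ⟨b, Ideal.mem_span_singleton_self b, rfl⟩) h1
  rw [mul_one] at h2
  rw [← hpst]
  refine star.cl_mono _ _ ?_ (star.mul_cl_le _ _ h2)
  rw [← IsLocalization.coeSubmodule_mul]
  refine IsLocalization.coeSubmodule_mono _ ?_
  rw [Ideal.mul_sup, Ideal.span_singleton_mul_span_singleton]
  refine sup_le Ideal.mul_le_right ?_
  rw [Ideal.span_singleton_le_iff_mem, mul_comm]
  exact hab

variable (star)

/-- `A` is a `∗`-multiplication ring: for all `f ∈ A` and `n ≥ 1` there is a finitely generated
submodule `J` of `A[ϖ⁻¹]` such that the `∗`-product of `J` and `(f, ϖⁿ)` is `A`. -/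
def IsMultiplicationRing : Prop :=
  ∀ (f : A) (n : ℕ), 1 ≤ n → ∃ J : Submodule A (Localization.Away ϖ), J.FG ∧
    star.starMul J (IsLocalization.coeSubmodule (Localization.Away ϖ) (Ideal.span {f, ϖ ^ n})) = 1

end PiStarOperation

/-- For a non-zero-divisor `ϖ` of a ring `B`: the ring `B` is `ϖ`-valuative if every finitely
generated ideal `I` of `B` which is open for the `ϖ`-adic topology (that is, which contains a power
of `ϖ`) is invertible, that is, `I J = B` for some `B`-submodule `J` of `B[ϖ⁻¹]`. -/
def IsPiValuative {B : Type*} [CommRing B] (ϖ : B) : Prop :=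
  ∀ I : Ideal B, I.FG → (∃ n : ℕ, ϖ ^ n ∈ I) →
    ∃ J : Submodule B (Localization.Away ϖ),
      IsLocalization.coeSubmodule (Localization.Away ϖ) I * J = 1

/-- The localization `A_p` at the prime ideal `p` is `ϖ`-valuative, for `ϖ ∈ A`. -/
def IsPiValuativeAt {A : Type*} [CommRing A] (ϖ : A) (p : Ideal A) (hp : p.IsPrime) : Prop :=
  IsPiValuative (algebraMap A (Localization.AtPrime p) ϖ)

/-- The ideal `(ϖⁿ X - f) A[ϖ⁻¹][X] ∩ A[X]` of the polynomial ring `A[X]`. -/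
noncomputable def linearContraction {A : Type*} [CommRing A] (ϖ f : A) (n : ℕ) :
    Ideal (Polynomial A) :=
  (Ideal.span {(Polynomial.C (ϖ ^ n) * Polynomial.X - Polynomial.C f).map
      (algebraMap A (Localization.Away ϖ))}).comap
    (Polynomial.mapRingHom (algebraMap A (Localization.Away ϖ)))

/-! Write `I = (f, ϖⁿ)`. In a local ring an invertible ideal is principal, generated by one of any
given generators, so `ϖ`-valuativity of `A_p` says that `f` and `ϖⁿ` are always comparable for
divisibility (`isPiValuative_iff_dvd_or_dvd`, `isPiValuativeAt_iff`).

If `(J I)^∗ = A` with `J` finitely generated, no prime `∗_f`-ideal `p` contains `J I`; so some `j ∈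
J` has `j f` or `j ϖⁿ` outside `p`, and the identity `(j f) ϖⁿ = (j ϖⁿ) f` compares `f` with `ϖⁿ` in
`A_p`. Conversely, a submodule of `A` contained in no maximal `∗_f`-ideal has `∗_f`-closure `A`
(`one_mem_finiteType_cl`). This local-global principle, applied to `(A : I) I`, gives the
multiplication property; applied to the conductor of an integral element, it gives integral
closedness.

The polynomial condition rests on a dictionary: `J` corresponds to the cofactor `G` in `F = (ϖⁿ X -
f) G`, with `J` spanned by the coefficients of `G`. From `J` to `F`, spacing out the exponents
prevents cancellation. From `F` to `J`, integral closedness forces `J I ⊆ A`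
(`coeff_mem_range_of_map_eq_X_sub_C_mul`). -/

/-! ### Valuativity of local rings as comparability with powers of `ϖ`. -/

/-- If every element is comparable, for divisibility, with the non-zero-divisor `c`, then every
element is comparable with the divisors of `c`. -/
theorem dvd_or_dvd_of_dvd {B : Type*} [CommRing B] {c : B} (hc : c ∈ nonZeroDivisors B)
    (h : ∀ f : B, f ∣ c ∨ c ∣ f) {f g : B} (hg : g ∣ c) : f ∣ g ∨ g ∣ f := by
  obtain ⟨v, hv⟩ := hg
  have hv0 : v ∈ nonZeroDivisors B := by
    rw [hv] at hc
    exact (mul_mem_nonZeroDivisors.1 hc).2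
  -- Since `c = g v`, comparing `f v` with `c` and cancelling `v` compares `f` with `g`.
  rcases h (f * v) with ⟨u, hu⟩ | ⟨u, hu⟩
  · refine Or.inl ⟨u, mul_right_mem_nonZeroDivisors_eq_zero_iff hv0 |>.1 ?_ |> sub_eq_zero.1⟩
    linear_combination hu - hv
  · refine Or.inr ⟨u, mul_right_mem_nonZeroDivisors_eq_zero_iff hv0 |>.1 ?_ |> sub_eq_zero.1⟩
    linear_combination hu + u * hv

/-- If every element is comparable with `c`, then finitely generated ideals become
principal, generated by a divisor of `c`, after adjoining `c`. -/
theorem exists_dvd_sup_span_eq_span {B : Type*} [CommRing B] {c : B} (hc : c ∈ nonZeroDivisors B)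
    (h : ∀ f : B, f ∣ c ∨ c ∣ f) {I : Ideal B} (hI : I.FG) :
    ∃ g, g ∣ c ∧ I ⊔ Ideal.span {c} = Ideal.span {g} := by
  induction I, hI using Submodule.fg_induction with
  | singleton f =>
    rcases h f with hf | hf
    · exact ⟨f, hf, sup_eq_left.2 (Ideal.span_singleton_le_span_singleton.2 hf)⟩
    · exact ⟨c, dvd_rfl, sup_eq_right.2 (Ideal.span_singleton_le_span_singleton.2 hf)⟩
  | sup I J _ _ hI hJ =>
    obtain ⟨f, hf, hIf⟩ := hI
    obtain ⟨g, hg, hJg⟩ := hJ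
    have : I ⊔ J ⊔ Ideal.span {c} = Ideal.span {f} ⊔ Ideal.span {g} := by
      rw [← hIf, ← hJg, sup_sup_sup_comm, sup_idem]
    rw [this]
    rcases dvd_or_dvd_of_dvd hc h hg with hfg | hfg
    · exact ⟨f, hf, sup_eq_left.2 (Ideal.span_singleton_le_span_singleton.2 hfg)⟩
    · exact ⟨g, hg, sup_eq_right.2 (Ideal.span_singleton_le_span_singleton.2 hfg)⟩

/-- A local ring is `ϖ`-valuative if and only if every element is comparable, for divisibility,
with every power of `ϖ`. -/
theorem isPiValuative_iff_dvd_or_dvd {B : Type*} [CommRing B] [IsLocalRing B] {ϖ : B}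
    (hϖ : ϖ ∈ nonZeroDivisors B) :
    IsPiValuative ϖ ↔ ∀ (f : B) (n : ℕ), f ∣ ϖ ^ n ∨ ϖ ^ n ∣ f := by
  have hinj : Function.Injective (algebraMap B (Localization.Away ϖ)) :=
    IsLocalization.injective _ (Submonoid.powers_le.2 hϖ)
  constructor
  · intro h f n
    obtain ⟨J, hJ⟩ := h (Ideal.span {f, ϖ ^ n}) (Submodule.fg_span (Set.toFinite _))
      ⟨n, Ideal.subset_span (by simp)⟩
    have key : ∀ z ∈ Ideal.span {f, ϖ ^ n}, ∀ j ∈ J, ∃ b, algebraMap B _ b = algebraMap B _ z * j :=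
      fun z hz j hj => Submodule.mem_one.1 <| hJ ▸ Submodule.mul_mem_mul
        ((IsLocalization.mem_coeSubmodule _ _).2 ⟨z, hz, rfl⟩) hj
    have hmem := (Submodule.one_le.1 hJ.ge)
    rw [IsLocalization.coeSubmodule_span, Set.image_pair, Submodule.span_insert, Submodule.sup_mul,
      Submodule.mem_sup] at hmem
    obtain ⟨y, hy, z, hz, hyz⟩ := hmem
    obtain ⟨a, ha, rfl⟩ := Submodule.mem_span_singleton_mul.1 hy
    obtain ⟨b, hb, rfl⟩ := Submodule.mem_span_singleton_mul.1 hz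
    have hfI : f ∈ Ideal.span {f, ϖ ^ n} := Ideal.subset_span (by simp)
    have hnI : ϖ ^ n ∈ Ideal.span {f, ϖ ^ n} := Ideal.subset_span (by simp)
    obtain ⟨u, hu⟩ := key f hfI a ha
    obtain ⟨v, hv⟩ := key _ hnI b hb
    have huv : u + v = 1 := hinj (by rw [map_add, hu, hv, hyz, map_one])
    -- Here `u = f a` and `v = ϖⁿ b`. If `u` is a unit, then `u ϖⁿ = f (ϖⁿ a)` with `ϖⁿ a ∈ B` gives
    -- `f ∣ ϖⁿ`; the other case is symmetric.
    rcases IsLocalRing.isUnit_or_isUnit_of_isUnit_add (huv ▸ isUnit_one) with hu' | hv'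
    · obtain ⟨w, hw⟩ := key _ hnI a ha
      refine Or.inl (hu'.dvd_mul_right.1 ⟨w, hinj ?_⟩)
      rw [map_mul, map_mul, hu, hw]
      ring
    · obtain ⟨w, hw⟩ := key _ hfI b hb
      refine Or.inr (hv'.dvd_mul_right.1 ⟨w, hinj ?_⟩)
      rw [map_mul, map_mul, hv, hw]
      ring
  · rintro h I hI ⟨n, hn⟩
    obtain ⟨g, hg, hIg⟩ := exists_dvd_sup_span_eq_span (pow_mem hϖ n) (fun f => h f n) hI
    rw [sup_eq_left.2 ((Ideal.span_singleton_le_iff_mem I).2 hn)] at hIg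
    have hu : IsUnit (algebraMap B (Localization.Away ϖ) g) :=
      isUnit_of_dvd_unit (map_dvd _ hg)
        (IsLocalization.map_units (Localization.Away ϖ) (⟨ϖ ^ n, n, rfl⟩ : Submonoid.powers ϖ))
    obtain ⟨u, hu⟩ := hu
    refine ⟨Submodule.span B {((u⁻¹ : (Localization.Away ϖ)ˣ) : Localization.Away ϖ)}, ?_⟩
    rw [hIg, IsLocalization.coeSubmodule_span_singleton, Submodule.span_mul_span,
      Set.singleton_mul_singleton, ← hu, Units.mul_inv, Submodule.one_eq_span]

/-- Valuativity of `A_p` in terms of elements of `A`. -/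
theorem isPiValuativeAt_iff {A : Type*} [CommRing A] {ϖ : A} (hϖ : ϖ ∈ nonZeroDivisors A)
    (p : Ideal A) (hp : p.IsPrime) :
    IsPiValuativeAt ϖ p hp ↔
      ∀ (f : A) (n : ℕ), ∃ s ∉ p, ∃ t, s * ϖ ^ n = t * f ∨ s * f = t * ϖ ^ n := by
  have hϖB : algebraMap A (Localization.AtPrime p) ϖ ∈ nonZeroDivisors (Localization.AtPrime p) :=
    IsLocalization.map_nonZeroDivisors_le p.primeCompl _ (Submonoid.mem_map_of_mem _ hϖ)
  have dvd_iff : ∀ a b : A, algebraMap A (Localization.AtPrime p) a ∣ algebraMap A _ b ↔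
      ∃ s ∉ p, ∃ t, s * b = t * a := by
    intro a b
    constructor
    · rintro ⟨c, hc⟩
      obtain ⟨t, s, rfl⟩ := IsLocalization.exists_mk'_eq p.primeCompl c
      rw [IsLocalization.mul_mk'_eq_mk'_of_mul, IsLocalization.eq_mk'_iff_mul_eq, ← map_mul,
        IsLocalization.eq_iff_exists p.primeCompl] at hc
      obtain ⟨c, hc⟩ := hc
      exact ⟨c * s, (c * s).2, c * t, by linear_combination hc⟩
    · rintro ⟨s, hs, t, h⟩
      have hu := IsLocalization.map_units (Localization.AtPrime p) (⟨s, hs⟩ : p.primeCompl)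
      refine hu.dvd_mul_left.1 ?_
      rw [← map_mul]
      exact map_dvd _ ⟨t, by rw [mul_comm a, ← h]⟩
  unfold IsPiValuativeAt
  rw [isPiValuative_iff_dvd_or_dvd hϖB]
  constructor
  · intro h f n
    have := h (algebraMap A _ f) n
    rw [← map_pow, dvd_iff, dvd_iff] at this
    rcases this with ⟨s, hs, t, h⟩ | ⟨s, hs, t, h⟩
    · exact ⟨s, hs, t, Or.inl h⟩
    · exact ⟨s, hs, t, Or.inr h⟩
  · intro h f n
    obtain ⟨a, s, rfl⟩ := IsLocalization.exists_mk'_eq p.primeCompl f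
    have hassoc : Associated (algebraMap A (Localization.AtPrime p) a)
        (IsLocalization.mk' (Localization.AtPrime p) a s) := by
      rw [← IsLocalization.mk'_spec (Localization.AtPrime p) a s]
      exact (associated_mul_unit_left _ _ (IsLocalization.map_units _ s))
    rw [← hassoc.dvd_iff_dvd_left, ← hassoc.dvd_iff_dvd_right, ← map_pow, dvd_iff, dvd_iff]
    obtain ⟨s, hs, t, h | h⟩ := h a n
    · exact Or.inl ⟨s, hs, t, h⟩
    · exact Or.inr ⟨s, hs, t, h⟩

/-! ### Integrality over the base ring. -/

open Polynomial
/-- The coefficients of a cofactor of a linear polynomial `X - x`, over an overring in which the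
base ring is integrally closed, lie in the base ring, even after multiplication by `x`. -/
theorem coeff_mem_range_of_map_eq_X_sub_C_mul {A K : Type*} [CommRing A] [CommRing K] [Algebra A K]
    [IsIntegrallyClosedIn A K] {F : A[X]} {G : K[X]} {x : K}
    (h : F.map (algebraMap A K) = (X - C x) * G) (i : ℕ) :
    G.coeff i ∈ (algebraMap A K).range ∧ x * G.coeff i ∈ (algebraMap A K).range := by
  have hint : ∀ y : K, IsIntegral A y → y ∈ (algebraMap A K).range := fun y hy =>
    IsIntegrallyClosedIn.algebraMap_eq_of_integral hy
  have hcoeff : ∀ i, algebraMap A K (F.coeff (i + 1)) = G.coeff i - x * G.coeff (i + 1) := by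
    intro i
    rw [← coeff_map, h, sub_mul, coeff_sub, coeff_X_mul, coeff_C_mul]
  have hcoeff0 : algebraMap A K (F.coeff 0) = - (x * G.coeff 0) := by
    rw [← coeff_map, h, sub_mul, coeff_sub, coeff_X_mul_zero, coeff_C_mul, zero_sub]
  have hsum : ∀ k, ∑ j ∈ Finset.range (k + 1), algebraMap A K (F.coeff j) * x ^ j =
      - (G.coeff k * x ^ (k + 1)) := by
    intro k
    induction k with
    | zero => simp [hcoeff0, mul_comm]
    | succ k ih => rw [Finset.sum_range_succ, ih, hcoeff]; ring
  -- Descending induction on `i`, starting above the degree of `G`, where the coefficients vanish.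
  suffices key : ∀ m i, G.natDegree < i + m →
      G.coeff i ∈ (algebraMap A K).range ∧ x * G.coeff i ∈ (algebraMap A K).range from
    key (G.natDegree + 1) i (by omega)
  intro m
  induction m with
  | zero =>
    intro i hi
    rw [coeff_eq_zero_of_natDegree_lt (by simpa using hi), mul_zero]
    exact ⟨zero_mem _, zero_mem _⟩
  | succ m ih =>
    intro i hi
    have hi' := (ih (i + 1) (by omega)).2
    have hg : G.coeff i ∈ (algebraMap A K).range := by
      rw [eq_add_of_sub_eq (hcoeff i).symm]
      exact add_mem ⟨_, rfl⟩ hi'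
    refine ⟨hg, hint _ ?_⟩
    obtain ⟨b, hb⟩ := hg
    rw [← hb]
    rcases eq_or_ne b 0 with rfl | hb0
    · simpa using isIntegral_zero
    -- By `hsum`, `x` is a root of `b X^(i+1) + ∑_{j ≤ i} F_j X^j`, whose coefficients lie in `A`;
    -- leading coefficient times root is integral, so `b x` is.
    have hdeg : (∑ j ∈ Finset.range (i + 1), C (F.coeff j) * X ^ j).degree <
        (C b * X ^ (i + 1)).degree := by
      rw [degree_C_mul_X_pow _ hb0, ← mem_degreeLT]
      refine Submodule.sum_mem _ fun j hj => mem_degreeLT.2 ?_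
      exact (degree_C_mul_X_pow_le _ _).trans_lt (by exact_mod_cast Finset.mem_range.1 hj)
    have hlead : (∑ j ∈ Finset.range (i + 1), C (F.coeff j) * X ^ j +
        C b * X ^ (i + 1)).leadingCoeff = b := by
      rw [leadingCoeff_add_of_degree_lt hdeg, leadingCoeff_C_mul_X_pow]
    have := isIntegral_leadingCoeff_smul
      (∑ j ∈ Finset.range (i + 1), C (F.coeff j) * X ^ j + C b * X ^ (i + 1)) x
      (by simp [hsum, hb])
    rwa [hlead, Algebra.smul_def, mul_comm] at this

/-- If `x` is integral over `A`, then some power, independent of `s` and `t`, of each `s = t x` in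
`A` multiplies `x` into `A`. -/
theorem IsIntegral.exists_pow_mul_mem_range {A K : Type*} [CommRing A] [CommRing K] [Algebra A K]
    {x : K} (hx : IsIntegral A x) : ∃ d : ℕ, ∀ t s : A, algebraMap A K s = algebraMap A K t * x →
      algebraMap A K (s ^ d) * x ∈ (algebraMap A K).range := by
  obtain ⟨P, hP, hPx⟩ := hx
  refine ⟨P.natDegree, fun t s hts => ?_⟩
  rw [hP.as_sum, eval₂_add, eval₂_finsetSum, eval₂_X_pow] at hPx
  -- With `d = deg P`, substitute the monic equation for `x ^ d` in `s^d x = t^d x^d x`; each `t^d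
  -- x^(i+1)` with `i < d` equals `t^(d-i-1) s^(i+1)`.
  have : algebraMap A K (s ^ P.natDegree) * x =
      - ∑ i ∈ Finset.range P.natDegree, algebraMap A K
        (P.coeff i * (t ^ (P.natDegree - (i + 1)) * s ^ (i + 1))) := by
    have h1 : algebraMap A K (s ^ P.natDegree) * x =
        algebraMap A K (t ^ P.natDegree) * x * x ^ P.natDegree := by
      rw [map_pow, hts, map_pow]
      ring
    rw [h1, eq_neg_of_add_eq_zero_left hPx, mul_neg, Finset.mul_sum]
    congr 1
    refine Finset.sum_congr rfl fun i hi => ?_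
    have hi' : P.natDegree = P.natDegree - (i + 1) + (i + 1) := by
      have := Finset.mem_range.1 hi
      omega
    simp only [eval₂_mul, eval₂_C, eval₂_X_pow, map_mul, map_pow, hts]
    nth_rewrite 1 [hi']
    ring
  rw [this]
  exact neg_mem (sum_mem fun i _ => ⟨_, rfl⟩)

/-! ### Strict closures, maximal `∗_f`-ideals and products of submodules. -/

namespace PiStarOperation

variable {A : Type*} [CommRing A] {ϖ : A} {star : PiStarOperation A ϖ}

theorem IsStrict.cl_le_one (hs : star.IsStrict) {N : Submodule A (Localization.Away ϖ)}
    (hN : N ≤ 1) : star.cl N ≤ 1 :=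
  (star.cl_mono _ _ hN).trans (le_of_eq hs)

theorem IsStrict.cl_eq_one (hs : star.IsStrict) {N : Submodule A (Localization.Away ϖ)}
    (hN : N ≤ 1) (h : 1 ∈ star.cl N) : star.cl N = 1 :=
  le_antisymm (hs.cl_le_one hN) (Submodule.one_le.2 h)

theorem coeSubmodule_comap_of_le_one {N : Submodule A (Localization.Away ϖ)} (hN : N ≤ 1) :
    IsLocalization.coeSubmodule (Localization.Away ϖ)
      (N.comap (Algebra.linearMap A (Localization.Away ϖ))) = N := by
  refine le_antisymm ?_ ?_
  · rintro _ ⟨y, hy, rfl⟩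
    exact hy
  · intro x hx
    obtain ⟨y, rfl⟩ := Submodule.mem_one.1 (hN hx)
    exact ⟨y, hx, rfl⟩

theorem algebraMap_mem_coeSubmodule_iff (hϖ : ϖ ∈ nonZeroDivisors A) {I : Ideal A} {a : A} :
    algebraMap A (Localization.Away ϖ) a ∈ IsLocalization.coeSubmodule (Localization.Away ϖ) I ↔
      a ∈ I := by
  have hinj : Function.Injective (algebraMap A (Localization.Away ϖ)) :=
    IsLocalization.injective _ (Submonoid.powers_le.2 hϖ)
  rw [IsLocalization.mem_coeSubmodule]
  exact ⟨fun ⟨b, hb, hba⟩ => hinj hba ▸ hb, fun ha => ⟨a, ha, rfl⟩⟩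

/-- Every proper `∗_f`-ideal is contained in a maximal `∗_f`-ideal. -/
theorem exists_le_isMaximalStarIdeal {I : Ideal A} (hI : I ≠ ⊤)
    (hI' : star.finiteType.IsStarIdeal I) : ∃ p, I ≤ p ∧ star.finiteType.IsMaximalStarIdeal p := by
  refine zorn_le_nonempty₀ {I : Ideal A | I ≠ ⊤ ∧ star.finiteType.IsStarIdeal I} ?_ I ⟨hI, hI'⟩
  intro c hc hchain y hy
  have hdir : DirectedOn (· ≤ ·) c := hchain.directedOn
  refine ⟨sSup c, ⟨?_, ?_⟩, fun z hz => le_sSup hz⟩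
  · rw [Ideal.ne_top_iff_one, Submodule.mem_sSup_of_directed ⟨y, hy⟩ hdir]
    rintro ⟨z, hz, hz1⟩
    exact (hc hz).1 ((Ideal.eq_top_iff_one z).2 hz1)
  · refine le_antisymm ?_ (star.finiteType.le_cl _)
    rintro x ⟨F, hF, hFc, hx⟩
    -- Finite type enters here: a finitely generated submodule of the union of a chain already lies
    -- in one member, which is closed.
    have key : ∃ z ∈ c, F ≤ IsLocalization.coeSubmodule (Localization.Away ϖ) z := by
      clear hx
      induction F, hF using Submodule.fg_induction with
      | singleton f =>
        obtain ⟨a, ha, rfl⟩ := hFc (Submodule.mem_span_singleton_self f)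
        obtain ⟨z, hz, haz⟩ := (Submodule.mem_sSup_of_directed ⟨y, hy⟩ hdir).1 ha
        exact ⟨z, hz, (Submodule.span_singleton_le_iff_mem _ _).2 ⟨a, haz, rfl⟩⟩
      | sup F₁ F₂ _ _ h₁ h₂ =>
        obtain ⟨z₁, hz₁, hF₁⟩ := h₁ (le_sup_left.trans hFc)
        obtain ⟨z₂, hz₂, hF₂⟩ := h₂ (le_sup_right.trans hFc)
        obtain ⟨z, hz, h₁, h₂⟩ := hdir z₁ hz₁ z₂ hz₂
        exact ⟨z, hz, sup_le (hF₁.trans (IsLocalization.coeSubmodule_mono _ h₁))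
          (hF₂.trans (IsLocalization.coeSubmodule_mono _ h₂))⟩
    obtain ⟨z, hz, hFz⟩ := key
    have hxz : x ∈ star.finiteType.clIdeal z := ⟨F, hF, hFz, hx⟩
    rw [(hc hz).2] at hxz
    exact IsLocalization.coeSubmodule_mono _ (le_sSup hz) hxz

/-- An `A`-submodule of `A` which is not contained in any maximal `∗_f`-ideal is `∗_f`-dense. -/
theorem one_mem_finiteType_cl (hs : star.IsStrict)
    {N : Submodule A (Localization.Away ϖ)} (hN : N ≤ 1)
    (h : ∀ p, star.finiteType.IsMaximalStarIdeal p →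
      ∃ a ∉ p, algebraMap A (Localization.Away ϖ) a ∈ N) :
    1 ∈ star.finiteType.cl N := by
  have hco := coeSubmodule_comap_of_le_one (hs.finiteType.cl_le_one hN)
  set I : Ideal A :=
    (star.finiteType.cl N).comap (Algebra.linearMap A (Localization.Away ϖ)) with hI
  by_cases htop : I = ⊤
  · rw [← hco, htop, IsLocalization.coeSubmodule_top]
    exact Submodule.one_le.1 le_rfl
  · have hstar : star.finiteType.IsStarIdeal I := by
      rw [IsStarIdeal, clIdeal, hco, star.finiteType.cl_cl]
    obtain ⟨p, hIp, hp⟩ := exists_le_isMaximalStarIdeal htop hstar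
    obtain ⟨a, hap, haN⟩ := h p hp
    exact absurd (hIp (show a ∈ I from star.finiteType.le_cl _ haN)) hap

/-- Each generator of `F` is a finite sum of products, so only finitely many left factors occur.
This cuts the possibly infinitely generated `(A : I)` down to a finitely generated `J`. -/
theorem _root_.Submodule.FG.exists_fg_le_mul {R S : Type*} [CommSemiring R] [CommSemiring S] [Algebra R S]
    {M N F : Submodule R S} (hF : F.FG) (hFMN : F ≤ M * N) :
    ∃ J : Submodule R S, J.FG ∧ J ≤ M ∧ F ≤ J * N := by
  induction F, hF using Submodule.fg_induction with
  | singleton f =>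
    have := (Submodule.span_singleton_le_iff_mem _ _).1 hFMN
    simp only [Submodule.span_singleton_le_iff_mem]
    clear hFMN
    induction this using Submodule.mul_induction_on' with
    | mem_mul_mem m hm n hn =>
      exact ⟨Submodule.span R {m}, Submodule.fg_span_singleton m,
        (Submodule.span_singleton_le_iff_mem _ _).2 hm,
        Submodule.mul_mem_mul (Submodule.mem_span_singleton_self m) hn⟩
    | add x _ y _ hx hy =>
      obtain ⟨J, hJ, hJM, hx⟩ := hx
      obtain ⟨J', hJ', hJM', hy⟩ := hy
      refine ⟨J ⊔ J', hJ.sup hJ', sup_le hJM hJM', ?_⟩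
      rw [Submodule.sup_mul]
      exact Submodule.add_mem_sup hx hy
  | sup F₁ F₂ _ _ h₁ h₂ =>
    obtain ⟨J₁, hJ₁, hM₁, h₁⟩ := h₁ (le_sup_left.trans hFMN)
    obtain ⟨J₂, hJ₂, hM₂, h₂⟩ := h₂ (le_sup_right.trans hFMN)
    refine ⟨J₁ ⊔ J₂, hJ₁.sup hJ₂, sup_le hM₁ hM₂, ?_⟩
    rw [Submodule.sup_mul]
    exact sup_le_sup h₁ h₂

theorem mul_coeSubmodule_span_pair {J : Submodule A (Localization.Away ϖ)} (f g : A) :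
    J * IsLocalization.coeSubmodule (Localization.Away ϖ) (Ideal.span {f, g}) =
      J * Submodule.span A {algebraMap A (Localization.Away ϖ) f} ⊔
        J * Submodule.span A {algebraMap A (Localization.Away ϖ) g} := by
  rw [IsLocalization.coeSubmodule_span, Set.image_pair, Submodule.span_insert, Submodule.mul_sup]

theorem mul_coeSubmodule_span_pair_le_iff {J N : Submodule A (Localization.Away ϖ)} {f g : A} :
    J * IsLocalization.coeSubmodule (Localization.Away ϖ) (Ideal.span {f, g}) ≤ N ↔
      ∀ j ∈ J, j * algebraMap A (Localization.Away ϖ) f ∈ N ∧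
        j * algebraMap A (Localization.Away ϖ) g ∈ N := by
  rw [mul_coeSubmodule_span_pair, sup_le_iff, Submodule.mul_le, Submodule.mul_le]
  constructor
  · exact fun h j hj => ⟨h.1 j hj _ (Submodule.mem_span_singleton_self _),
      h.2 j hj _ (Submodule.mem_span_singleton_self _)⟩
  · intro h
    constructor
    · intro j hj y hy
      obtain ⟨a, rfl⟩ := Submodule.mem_span_singleton.1 hy
      rw [mul_smul_comm]
      exact N.smul_mem _ (h j hj).1
    · intro j hj y hy
      obtain ⟨a, rfl⟩ := Submodule.mem_span_singleton.1 hy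
      rw [mul_smul_comm]
      exact N.smul_mem _ (h j hj).2

/-! ### The multiplication property and valuative localizations. -/

theorem IsMultiplicationRing.isPiValuativeAt (hϖ : ϖ ∈ nonZeroDivisors A)
    (h : star.IsMultiplicationRing) (p : Ideal A) (hp : p.IsPrime)
    (hp' : star.finiteType.IsStarIdeal p) : IsPiValuativeAt ϖ p hp := by
  have hinj : Function.Injective (algebraMap A (Localization.Away ϖ)) :=
    IsLocalization.injective _ (Submonoid.powers_le.2 hϖ)
  rw [isPiValuativeAt_iff hϖ]
  intro f n
  rcases Nat.eq_zero_or_pos n with rfl | hn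
  · exact ⟨1, hp.one_notMem, f, Or.inr (by simp)⟩
  obtain ⟨J, hJ, hJ1⟩ := h f n hn
  have hle : J * IsLocalization.coeSubmodule (Localization.Away ϖ) (Ideal.span {f, ϖ ^ n}) ≤ 1 :=
    (star.le_cl _).trans hJ1.le
  have hnot : ¬ J * IsLocalization.coeSubmodule (Localization.Away ϖ) (Ideal.span {f, ϖ ^ n}) ≤
      IsLocalization.coeSubmodule (Localization.Away ϖ) p := by
    -- `J I` is finitely generated, so if it lay in `p`, its `∗`-closure, which contains `1`, would
    -- lie in the `∗_f`-closure of `p`, that is, in `p`.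
    intro hJp
    have h1 : algebraMap A (Localization.Away ϖ) 1 ∈ star.finiteType.clIdeal p := by
      refine ⟨_, hJ.mul ?_, hJp, ?_⟩
      · rw [IsLocalization.coeSubmodule_span]
        exact Submodule.fg_span ((Set.toFinite _).image _)
      · rw [map_one]
        exact Submodule.one_le.1 hJ1.ge
    rw [hp', algebraMap_mem_coeSubmodule_iff hϖ] at h1
    exact hp.one_notMem h1
  rw [mul_coeSubmodule_span_pair_le_iff] at hle hnot
  push Not at hnot
  obtain ⟨j, hj, hjp⟩ := hnot
  obtain ⟨a, ha⟩ := Submodule.mem_one.1 (hle j hj).1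
  obtain ⟨b, hb⟩ := Submodule.mem_one.1 (hle j hj).2
  rw [← ha, ← hb, algebraMap_mem_coeSubmodule_iff hϖ, algebraMap_mem_coeSubmodule_iff hϖ] at hjp
  by_cases hap : a ∈ p
  · refine ⟨b, hjp hap, a, Or.inr (hinj ?_)⟩
    rw [map_mul, map_mul, ha, hb]
    ring
  · refine ⟨a, hap, b, Or.inl (hinj ?_)⟩
    rw [map_mul, map_mul, ha, hb]
    ring

/-- The natural candidate for an inverse of `I` is `1 / I`. Comparability at each maximal
`∗_f`-ideal `p` produces an element of `(1 / I) I` outside `p`, so `1` lies in the `∗_f`-closure,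
hence in `F^∗` for a finitely generated `F ≤ (1 / I) I`. -/
theorem isMultiplicationRing_of_isPiValuativeAt (hϖ : ϖ ∈ nonZeroDivisors A)
    (hs : star.IsStrict)
    (h : ∀ (p : Ideal A) (hp : star.finiteType.IsMaximalStarIdeal p),
      IsPiValuativeAt ϖ p (hp.isPrime hϖ hs.finiteType)) :
    star.IsMultiplicationRing := by
  intro f n _
  set I := IsLocalization.coeSubmodule (Localization.Away ϖ) (Ideal.span {f, ϖ ^ n}) with hI
  have hfI : algebraMap A (Localization.Away ϖ) f ∈ I :=
    (algebraMap_mem_coeSubmodule_iff hϖ).2 (Ideal.subset_span (by simp))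
  have hnI : algebraMap A (Localization.Away ϖ) (ϖ ^ n) ∈ I :=
    (algebraMap_mem_coeSubmodule_iff hϖ).2 (Ideal.subset_span (by simp))
  have hle : (1 / I) * I ≤ 1 := by
    rw [← Submodule.le_div_iff_mul_le]
  have hinv : algebraMap A (Localization.Away ϖ) (ϖ ^ n) * IsLocalization.mk' _ 1
      (⟨ϖ ^ n, n, rfl⟩ : Submonoid.powers ϖ) = 1 := by
    rw [mul_comm, IsLocalization.mk'_spec, map_one]
  set w : Localization.Away ϖ := IsLocalization.mk' _ 1 (⟨ϖ ^ n, n, rfl⟩ : Submonoid.powers ϖ)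
  have hone : 1 ∈ star.finiteType.cl ((1 / I) * I) := by
    refine one_mem_finiteType_cl hs hle fun p hp => ?_
    obtain ⟨s, hsp, t, hst⟩ := (isPiValuativeAt_iff hϖ p _).1 (h p hp) f n
    -- The fraction `j = b / ϖⁿ` satisfies `j f = a` and `j ϖⁿ = b`, so it multiplies `I` into `A`.
    -- It is used with `s` in the role of `a` or of `b`, according to the direction of divisibility.
    have hmem : ∀ a b : A, a * ϖ ^ n = b * f →
        algebraMap A _ b * w ∈ 1 / I ∧ algebraMap A _ a = algebraMap A _ b * w * algebraMap A _ f ∧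
        algebraMap A _ b = algebraMap A _ b * w * algebraMap A _ (ϖ ^ n) := by
      intro a b hab
      have hab' := congrArg (algebraMap A (Localization.Away ϖ)) hab
      rw [map_mul, map_mul] at hab'
      have h1 : algebraMap A _ a = algebraMap A _ b * w * algebraMap A _ f := by
        linear_combination w * hab' - algebraMap A _ a * hinv
      have h2 : algebraMap A _ b = algebraMap A _ b * w * algebraMap A _ (ϖ ^ n) := by
        linear_combination - algebraMap A _ b * hinv
      refine ⟨?_, h1, h2⟩
      rw [← Submodule.span_singleton_le_iff_mem, Submodule.le_div_iff_mul_le,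
        mul_coeSubmodule_span_pair_le_iff]
      intro j hj
      obtain ⟨c, rfl⟩ := Submodule.mem_span_singleton.1 hj
      rw [smul_mul_assoc, smul_mul_assoc, ← h1, ← h2]
      exact ⟨Submodule.smul_mem _ _ (Submodule.mem_one.2 ⟨a, rfl⟩),
        Submodule.smul_mem _ _ (Submodule.mem_one.2 ⟨b, rfl⟩)⟩
    refine ⟨s, hsp, ?_⟩
    rcases hst with hst | hst
    · obtain ⟨hj, h1, -⟩ := hmem s t hst
      rw [h1]
      exact Submodule.mul_mem_mul hj hfI
    · obtain ⟨hj, -, h2⟩ := hmem t s hst.symm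
      rw [h2]
      exact Submodule.mul_mem_mul hj hnI
  obtain ⟨F, hF, hFI, hF1⟩ := hone
  obtain ⟨J, hJ, hJI, hFJ⟩ := hF.exists_fg_le_mul hFI
  exact ⟨J, hJ, hs.cl_eq_one ((mul_le_mul' hJI le_rfl).trans hle)
    (star.cl_mono _ _ hFJ hF1)⟩

/-- For `x` integral, the conductor `N = {y ∈ A | y x ∈ A}` meets the complement of every maximal
`∗_f`-ideal, so `1 ∈ N^{∗_f}`. Then `x ∈ x N^{∗_f} ⊆ (x N)^{∗_f} ⊆ A`. -/
theorem isIntegrallyClosedIn_of_isPiValuativeAt (hϖ : ϖ ∈ nonZeroDivisors A)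
    (hs : star.IsStrict)
    (h : ∀ (p : Ideal A) (hp : star.finiteType.IsMaximalStarIdeal p),
      IsPiValuativeAt ϖ p (hp.isPrime hϖ hs.finiteType)) :
    IsIntegrallyClosedIn A (Localization.Away ϖ) := by
  have hinj : Function.Injective (algebraMap A (Localization.Away ϖ)) :=
    IsLocalization.injective _ (Submonoid.powers_le.2 hϖ)
  refine isIntegrallyClosedIn_iff.2 ⟨hinj, fun {x} hx => ?_⟩
  obtain ⟨d, hd⟩ := hx.exists_pow_mul_mem_range
  obtain ⟨g, ⟨_, n, rfl⟩, hgx⟩ := IsLocalization.exists_mk'_eq (Submonoid.powers ϖ) x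
  rw [eq_comm, IsLocalization.eq_mk'_iff_mul_eq] at hgx
  have hunit := IsLocalization.map_units (Localization.Away ϖ)
    (⟨ϖ ^ n, n, rfl⟩ : Submonoid.powers ϖ)
  -- the conductor of `x` into `A`
  set N : Submodule A (Localization.Away ϖ) := 1 ⊓ (1 / Submodule.span A {x}) with hN
  have hmem : ∀ y, y ∈ N ↔ y ∈ (1 : Submodule A (Localization.Away ϖ)) ∧
      y * x ∈ (1 : Submodule A (Localization.Away ϖ)) := by
    intro y
    rw [hN, Submodule.mem_inf, Submodule.mem_div_iff_forall_mul_mem]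
    refine and_congr_right fun _ => ⟨fun H => H x (Submodule.mem_span_singleton_self x), ?_⟩
    intro H z hz
    obtain ⟨c, rfl⟩ := Submodule.mem_span_singleton.1 hz
    rw [mul_smul_comm]
    exact Submodule.smul_mem _ _ H
  have hone : 1 ∈ star.finiteType.cl N := by
    refine one_mem_finiteType_cl hs inf_le_left fun p hp => ?_
    have hprime := hp.isPrime hϖ hs.finiteType
    simp only [hmem]
    obtain ⟨s, hsp, t, hst⟩ := (isPiValuativeAt_iff hϖ p _).1 (h p hp) g n
    have hst' := hst.imp (congrArg (algebraMap A (Localization.Away ϖ)))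
      (congrArg (algebraMap A (Localization.Away ϖ)))
    simp only [map_mul, ← hgx] at hst'
    -- Either `s = t x`, and then `s ^ d` is in the conductor by integrality, or `s x = t`, and `s`
    -- itself is.
    rcases hst' with hst' | hst'
    · refine ⟨s ^ d, fun hsd => hsp (hprime.mem_of_pow_mem _ hsd), Submodule.mem_one.2 ⟨_, rfl⟩,
        Submodule.mem_one.2 (hd t s (hunit.mul_left_injective ?_))⟩
      simpa only [mul_assoc] using hst'
    · refine ⟨s, hsp, Submodule.mem_one.2 ⟨_, rfl⟩,
        Submodule.mem_one.2 ⟨t, hunit.mul_left_injective ?_⟩⟩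
      simpa only [mul_assoc] using hst'.symm
  have hx1 : x * 1 ∈ Submodule.span A {x} * star.finiteType.cl N :=
    Submodule.mul_mem_mul (Submodule.mem_span_singleton_self x) hone
  rw [mul_one] at hx1
  refine Submodule.mem_one.1 (hs.finiteType.cl_le_one ?_ (star.finiteType.mul_cl_le _ _ hx1))
  rw [mul_comm, ← Submodule.le_div_iff_mul_le]
  exact inf_le_right

/-! ### The polynomial criterion. -/

/-- In a `∗`-multiplication ring, the contraction of `ϖⁿ X - f` contains a polynomial with
`∗`-unit content. -/
theorem IsMultiplicationRing.exists_mem_linearContraction (hs : star.IsStrict)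
    (h : star.IsMultiplicationRing) (f : A) {n : ℕ} (hn : 1 ≤ n) :
    ∃ F ∈ linearContraction ϖ f n, star.clIdeal F.contentIdeal = 1 := by
  obtain ⟨J, hJ, hJ1⟩ := h f n hn
  have hle : J * IsLocalization.coeSubmodule (Localization.Away ϖ) (Ideal.span {f, ϖ ^ n}) ≤ 1 :=
    (star.le_cl _).trans hJ1.le
  have hle' := mul_coeSubmodule_span_pair_le_iff.1 hle
  obtain ⟨k, j, rfl⟩ := Submodule.fg_iff_exists_fin_generating_family.1 hJ
  have hjJ : ∀ i, j i ∈ Submodule.span A (Set.range j) := fun i =>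
    Submodule.subset_span (Set.mem_range_self i)
  choose a ha using fun i => Submodule.mem_one.1 (hle' _ (hjJ i)).1
  choose b hb using fun i => Submodule.mem_one.1 (hle' _ (hjJ i)).2
  -- The cofactor is `∑ j_i X^(2i)`: even exponents keep the terms `j_i ϖⁿ` in odd degree and `-j_i
  -- f` in even degree from colliding.
  let F : A[X] := ∑ i : Fin k, (C (b i) * X ^ (2 * (i : ℕ) + 1) - C (a i) * X ^ (2 * (i : ℕ)))
  have hmap : F.map (algebraMap A (Localization.Away ϖ)) =
      (C (ϖ ^ n) * X - C f).map (algebraMap A (Localization.Away ϖ)) *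
        ∑ i : Fin k, C (j i) * X ^ (2 * (i : ℕ)) := by
    simp only [F, Polynomial.map_sum, Finset.mul_sum]
    refine Finset.sum_congr rfl fun i _ => ?_
    simp only [Polynomial.map_sub, Polynomial.map_mul, map_C, Polynomial.map_pow, map_X, ha, hb,
      C_mul]
    ring
  have hcoeff_even : ∀ i : Fin k, F.coeff (2 * (i : ℕ)) = - a i := by
    intro i
    simp only [F, finsetSum_coeff, coeff_sub, coeff_C_mul, coeff_X_pow]
    rw [Finset.sum_eq_single i]
    · simp
    · intro l _ hl
      have h1 : 2 * (i : ℕ) ≠ 2 * (l : ℕ) := fun h => hl (Fin.ext (by omega))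
      have h2 : 2 * (i : ℕ) ≠ 2 * (l : ℕ) + 1 := by omega
      simp [h1, h2]
    · simp
  have hcoeff_odd : ∀ i : Fin k, F.coeff (2 * (i : ℕ) + 1) = b i := by
    intro i
    simp only [F, finsetSum_coeff, coeff_sub, coeff_C_mul, coeff_X_pow]
    rw [Finset.sum_eq_single i]
    · simp
    · intro l _ hl
      have h1 : 2 * (i : ℕ) + 1 ≠ 2 * (l : ℕ) := by omega
      have h2 : (i : ℕ) ≠ l := fun h => hl (Fin.ext h.symm)
      simp [h1, h2]
    · simp
  refine ⟨F, Ideal.mem_comap.2 ?_, le_antisymm (hs.cl_le_one ?_) ?_⟩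
  · rw [coe_mapRingHom, hmap]
    exact Ideal.mul_mem_right _ _ (Ideal.mem_span_singleton_self _)
  · rw [← IsLocalization.coeSubmodule_top (R := A) (Localization.Away ϖ)]
    exact IsLocalization.coeSubmodule_mono _ le_top
  · refine hJ1.ge.trans (star.cl_mono _ _ (mul_coeSubmodule_span_pair_le_iff.2 fun x hx => ?_))
    induction hx using Submodule.span_induction with
    | mem x hx =>
      obtain ⟨i, rfl⟩ := hx
      rw [← ha, ← hb]
      refine ⟨⟨a i, ?_, rfl⟩, ⟨b i, ?_, rfl⟩⟩
      · rw [SetLike.mem_coe, ← neg_neg (a i), ← hcoeff_even]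
        exact neg_mem (coeff_mem_contentIdeal _ _)
      · rw [SetLike.mem_coe, ← hcoeff_odd]
        exact coeff_mem_contentIdeal _ _
    | zero => simp only [zero_mul, zero_mem, and_self]
    | add x y _ _ hx hy =>
      rw [add_mul, add_mul]
      exact ⟨add_mem hx.1 hy.1, add_mem hx.2 hy.2⟩
    | smul c x _ hx =>
      rw [smul_mul_assoc, smul_mul_assoc]
      exact ⟨Submodule.smul_mem _ _ hx.1, Submodule.smul_mem _ _ hx.2⟩

/-- With `F = (ϖⁿ X - f) G`, let `J` be spanned by the coefficients of `G`. Each coefficient of `F`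
is a difference of elements of `J ϖⁿ` and `J f`, so `c(F) ⊆ J I`. Integral closedness gives `J I ⊆
A`. -/
theorem isMultiplicationRing_of_exists_mem_linearContraction (hs : star.IsStrict)
    [IsIntegrallyClosedIn A (Localization.Away ϖ)]
    (h : ∀ (f : A) (n : ℕ), 1 ≤ n →
      ∃ F ∈ linearContraction ϖ f n, star.clIdeal F.contentIdeal = 1) :
    star.IsMultiplicationRing := by
  intro f n hn
  obtain ⟨F, hF, hF1⟩ := h f n hn
  obtain ⟨G, hG⟩ := Ideal.mem_span_singleton'.1 (Ideal.mem_comap.1 hF)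
  rw [coe_mapRingHom] at hG
  have hinv : algebraMap A (Localization.Away ϖ) (ϖ ^ n) * IsLocalization.mk' _ 1
      (⟨ϖ ^ n, n, rfl⟩ : Submonoid.powers ϖ) = 1 := by
    rw [mul_comm, IsLocalization.mk'_spec, map_one]
  set c := algebraMap A (Localization.Away ϖ) (ϖ ^ n)
  set w : Localization.Away ϖ := IsLocalization.mk' _ 1 (⟨ϖ ^ n, n, rfl⟩ : Submonoid.powers ϖ)
  -- Normalizing to the factor `X - f / ϖⁿ` moves `ϖⁿ` into the cofactor. The coefficients `ϖⁿ g_i`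
  -- and their multiples `(f / ϖⁿ) ϖⁿ g_i = f g_i` then both lie in `A`.
  have hG' : F.map (algebraMap A (Localization.Away ϖ)) =
      (X - C (w * algebraMap A _ f)) * (C c * G) := by
    have hinv' : (C c * C w : (Localization.Away ϖ)[X]) = 1 := by rw [← C_mul, hinv, C_1]
    rw [← hG]
    simp only [Polynomial.map_sub, Polynomial.map_mul, map_C, map_X, C_mul]
    linear_combination G * C (algebraMap A _ f) * hinv'
  have hcoeff := coeff_mem_range_of_map_eq_X_sub_C_mul hG'
  have hG1 : ∀ i, G.coeff i * algebraMap A _ f ∈ (1 : Submodule A (Localization.Away ϖ)) ∧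
      G.coeff i * c ∈ (1 : Submodule A (Localization.Away ϖ)) := by
    intro i
    obtain ⟨⟨b, hb⟩, ⟨a, ha⟩⟩ := hcoeff i
    rw [coeff_C_mul] at ha hb
    refine ⟨Submodule.mem_one.2 ⟨a, ?_⟩, Submodule.mem_one.2 ⟨b, ?_⟩⟩
    · rw [ha]
      linear_combination G.coeff i * algebraMap A _ f * hinv
    · rw [hb, mul_comm]
  have hmem : ∀ i, G.coeff i ∈ Submodule.span A (G.coeff '' G.support) := by
    intro i
    by_cases hi : i ∈ G.support
    · exact Submodule.subset_span ⟨i, hi, rfl⟩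
    · rw [notMem_support_iff.1 hi]
      exact zero_mem _
  have hle : Submodule.span A (G.coeff '' G.support) *
      IsLocalization.coeSubmodule (Localization.Away ϖ) (Ideal.span {f, ϖ ^ n}) ≤ 1 := by
    rw [← Submodule.le_div_iff_mul_le, Submodule.span_le]
    rintro _ ⟨i, -, rfl⟩
    rw [SetLike.mem_coe, ← Submodule.span_singleton_le_iff_mem, Submodule.le_div_iff_mul_le,
      mul_coeSubmodule_span_pair_le_iff]
    intro y hy
    obtain ⟨r, rfl⟩ := Submodule.mem_span_singleton.1 hy
    rw [smul_mul_assoc, smul_mul_assoc]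
    exact ⟨Submodule.smul_mem _ _ (hG1 i).1, Submodule.smul_mem _ _ (hG1 i).2⟩
  refine ⟨Submodule.span A (G.coeff '' G.support), Submodule.fg_span (Set.toFinite _),
    le_antisymm (hs.cl_le_one hle) (hF1.ge.trans (star.cl_mono _ _ ?_))⟩
  have hle' := mul_coeSubmodule_span_pair_le_iff.1
    (le_refl (Submodule.span A (G.coeff '' G.support) *
      IsLocalization.coeSubmodule (Localization.Away ϖ) (Ideal.span {f, ϖ ^ n})))
  rw [contentIdeal_def, IsLocalization.coeSubmodule_span, Submodule.span_le]
  rintro _ ⟨a, ha, rfl⟩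
  obtain ⟨i, -, rfl⟩ := mem_coeffs_iff.1 ha
  rw [SetLike.mem_coe, ← coeff_map, ← hG]
  simp only [Polynomial.map_sub, Polynomial.map_mul, map_C, map_X]
  rw [mul_sub, coeff_sub, coeff_mul_C, mul_left_comm, coeff_C_mul, mul_comm c]
  refine sub_mem ?_ (hle' _ (hmem i)).1
  cases i with
  | zero => simp only [coeff_mul_X_zero, zero_mul, zero_mem]
  | succ i =>
    rw [coeff_mul_X]
    exact (hle' _ (hmem i)).2

end PiStarOperation

theorem mainTheorem10 {A : Type*} [CommRing A] (ϖ : A) (hϖ : ϖ ∈ nonZeroDivisors A)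
    (hϖ' : ¬ IsUnit ϖ) (star : PiStarOperation A ϖ) (hstar : star.IsStrict) :
    List.TFAE [
      star.IsMultiplicationRing,
      IsIntegrallyClosedIn A (Localization.Away ϖ) ∧
        ∀ (f : A) (n : ℕ), 1 ≤ n →
          ∃ F ∈ linearContraction ϖ f n, star.clIdeal F.contentIdeal = 1,
      ∀ (p : Ideal A) (hp : star.finiteType.IsMaximalStarIdeal p),
        IsPiValuativeAt ϖ p (hp.isPrime hϖ hstar.finiteType),
      ∀ (p : Ideal A) (hp : p.IsPrime), star.finiteType.IsStarIdeal p →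
        IsPiValuativeAt ϖ p hp] := by
  tfae_have 1 → 4 := fun h p hp hp' => h.isPiValuativeAt hϖ p hp hp'
  tfae_have 4 → 3 := fun h p hp => h p (hp.isPrime hϖ hstar.finiteType) hp.1.2
  tfae_have 3 → 1 := PiStarOperation.isMultiplicationRing_of_isPiValuativeAt hϖ hstar
  tfae_have 2 → 1 := fun ⟨_, h⟩ =>
    PiStarOperation.isMultiplicationRing_of_exists_mem_linearContraction hstar h
  -- Integral closedness is a local argument, so it is reached through valuativity at the maximal
  -- `∗_f`-ideals.
  tfae_have 1 → 2 := fun h =>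
    ⟨PiStarOperation.isIntegrallyClosedIn_of_isPiValuativeAt hϖ hstar fun p hp =>
      h.isPiValuativeAt hϖ p (hp.isPrime hϖ hstar.finiteType) hp.1.2,
      fun f _ hn => h.exists_mem_linearContraction hstar f hn⟩
  tfae_finish
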